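/- **Setting.** For a feature matrix $\Phi\in\mathbb{R}^{k\times d}$, whose rows are the feature vectors of the $k$ actions, and $\epsilon\ge 0$, let $\mathcal H_\Phi^\epsilon=\{\Phi\theta+\Delta:\theta\in\mathbb{R}^d,\ \Delta\in[-\epsilon,\epsilon]^k\}$. In each round $t=1,\dots,n$ of a stochastic bandit with mean reward vector $\mu\in\mathbb{R}^k$, the learner chooses an action $X_t\in\{1,\dots,k\}$ as a measurable function of an internal random seed and of the actions and rewards of the earlier rounds, and observes the reward $Y_t=\mu_{X_t}+\eta_t$, where $\eta_1,\eta_2,\dots$ are independent $1$-subgaussian random variables, independent of the seed. The expected regret is $R_n=\mathbb{E}\big[\sum_{t=1}^n(\max_a\mu_a-\mu_{X_t})\big]$. **Theorem.** Let $k\ge 2$ and $1\le d\le k$. There is a feature matrix $\Phi\in\mathbb{R}^{k\times d}$ with pairwise distinct rows that span $\mathbb{R}^d$ such that for all $\epsilon\ge 0$ and $n\ge 0$, every bandit algorithm and every noise sequence as above, there is a mean reward vector $\mu\in\mathcal H_\Phi^\epsilon$ with $$\max_a\mu_a-\min_a\mu_a\le 2\epsilon\sqrt{\frac{d-1}{8\log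 k}}$$ for which the expected regret of the algorithm satisfies $$R_n\ \ge\ \epsilon\,\min\Big(n,\frac{k-1}{2}\Big)\sqrt{\frac{d-1}{8\log k}}.$$ -/

import Mathlib

open MeasureTheory ProbabilityTheory
open scoped Pointwise

/-- The hypothesis class `Range(Φ) + [-ε, ε]^k` of mean reward vectors that are linear in the
features (the rows of `Φ`) up to an error of at most `ε` in the maximum norm. -/
def misspecifiedClass {k d : ℕ} (Φ : Matrix (Fin k) (Fin d) ℝ) (ε : ℝ) : Set (Fin k → ℝ) :=
  Set.range (fun θ : Fin d → ℝ => Φ.mulVec θ) + {Δ : Fin k → ℝ | ∀ a, Δ a ∈ Set.Icc (-ε) ε}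

/-- A (possibly randomised) bandit algorithm with `k` actions. It draws an internal random seed
from a probability space `S` before the first round; the action of each round is then a measurable
function of the seed and of the history (the actions and rewards of all earlier rounds).
Rounds are numbered from `0`. -/
structure BanditAlgorithm (k : ℕ) (S : Type*) [MeasurableSpace S] where
  seedLaw : Measure S
  isProbabilityMeasure : IsProbabilityMeasure seedLaw
  choose : (t : ℕ) → S → (Fin t → Fin k × ℝ) → Fin k
  measurable_choose : ∀ t : ℕ,
    Measurable (fun p : S × (Fin t → Fin k × ℝ) => choose t p.1 p.2)

namespace BanditAlgorithm

variable {k : ℕ} {S : Type*} [MeasurableSpace S]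

/-- The actions and rewards of the first `t` rounds, when the algorithm has drawn the seed `s`,
the mean reward vector is `μ`, and the noise of round `r` has the value `z r`: the reward of
round `r` is the mean reward of the action taken plus `z r`. -/
def history (A : BanditAlgorithm k S) (μ : Fin k → ℝ) (s : S) (z : ℕ → ℝ) :
    (t : ℕ) → Fin t → Fin k × ℝ
  | 0 => Fin.elim0
  | t + 1 =>
      Fin.snoc (α := fun _ => Fin k × ℝ) (A.history μ s z t)
        (A.choose t s (A.history μ s z t), μ (A.choose t s (A.history μ s z t)) + z t)

/-- The action taken in round `t`. -/
def action (A : BanditAlgorithm k S) (μ : Fin k → ℝ) (s : S) (z : ℕ → ℝ) (t : ℕ) : Fin k :=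
  A.choose t s (A.history μ s z t)

/-- The expected regret after `n` rounds, when seed and noise are the random variables
`U` and `η 0, η 1, …` on the measure space `(Ω, P)`. -/
noncomputable def regret {Ω : Type*} [MeasurableSpace Ω] (P : Measure Ω)
    (A : BanditAlgorithm k S) (U : Ω → S) (η : ℕ → Ω → ℝ) (μ : Fin k → ℝ) (n : ℕ) : ℝ :=
  ∫ ω, ∑ t ∈ Finset.range n,
    ((⨆ a, μ a) - μ (A.action μ (U ω) (fun r => η r ω) t)) ∂P

end BanditAlgorithm

/-! Write δ = ε√((d-1)/(8 log k)). The hard instances are needles: mean vectors c·eᵢ with c = 3δ/2,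
at an unknown position i.

If c ≤ ε, a needle is pure misspecification, whatever the features. Otherwise take rows that are
unit vectors with pairwise inner products at most t = ε/c. Then θ = c·φᵢ reproduces the needle at i
and errs by at most ct = ε elsewhere. Enough such vectors exist because normalised random signs are
nearly orthogonal to any given exponentially large family (`exists_sign_vector_abs_sum_lt`).

Until the needle is hit, the run coincides with the run for mean zero, seed and noise being fixed.
That run tries at most t + 1 actions in rounds 0, …, t, so most needles are missed
(`le_sum_gap_single`). Averaging the regret over i yields a bad needle; the factor 3/2 pays for the
averaging and stays below the allowed range 2δ. -/

/-! ### Incoherent unit vectors -/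

/-- If `m` unit vectors are given and `2 m ≤ exp (s² / 2)`, then some sign vector has inner product
smaller than `s` in absolute value with each of them. -/
theorem exists_sign_vector_abs_sum_lt {d : ℕ} {ι : Type*} (J : Finset ι) (v : ι → Fin d → ℝ)
    (hv : ∀ j ∈ J, ∑ i, v j i ^ 2 = 1) (s : ℝ) (hs : 0 ≤ s)
    (hJ : 2 * (J.card : ℝ) ≤ Real.exp (s ^ 2 / 2)) :
    ∃ σ : Fin d → ℝ, (∀ i, σ i ^ 2 = 1) ∧ ∀ j ∈ J, |∑ i, v j i * σ i| < s := by
  classical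
  -- The mean of cosh(s⟨vⱼ, σ⟩) over all signs σ is at most exp(s²/2). If every σ failed, then
  -- cosh(s²) ≤ |J| exp(s²/2) ≤ exp(s²)/2 < cosh(s²).
  by_contra! hcon
  let T : Finset (Fin d → ℝ) := Fintype.piFinset fun _ => ({1, -1} : Finset ℝ)
  have hpair : ∀ f : ℝ → ℝ, ∑ x ∈ ({1, -1} : Finset ℝ), f x = f 1 + f (-1) := fun f =>
    Finset.sum_pair (by norm_num)
  have hT : ∀ σ ∈ T, ∀ i, σ i ^ 2 = 1 := by
    intro σ hσ i
    have := Fintype.mem_piFinset.1 hσ i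
    simp only [Finset.mem_insert, Finset.mem_singleton] at this
    rcases this with h | h <;> rw [h] <;> norm_num
  have hTcard : (T.card : ℝ) = 2 ^ d := by
    have : ({1, -1} : Finset ℝ).card = 2 := Finset.card_pair (by norm_num)
    simp [T, Fintype.card_piFinset, this]
  have hexp : ∀ c : ℝ, ∀ j ∈ J, c ^ 2 = s ^ 2 →
      ∑ σ ∈ T, Real.exp (c * ∑ i, v j i * σ i) ≤ 2 ^ d * Real.exp (s ^ 2 / 2) := by
    intro c j hj hc
    calc ∑ σ ∈ T, Real.exp (c * ∑ i, v j i * σ i)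
        = ∑ σ ∈ T, ∏ i, Real.exp (c * (v j i * σ i)) := by
          refine Finset.sum_congr rfl fun σ _ => ?_
          rw [Finset.mul_sum, Real.exp_sum]
      _ = ∏ i, ∑ x ∈ ({1, -1} : Finset ℝ), Real.exp (c * (v j i * x)) :=
          (Finset.prod_univ_sum (fun _ => ({1, -1} : Finset ℝ))
            (fun i x => Real.exp (c * (v j i * x)))).symm
      _ = ∏ i, (2 * Real.cosh (c * v j i)) := by
          refine Finset.prod_congr rfl fun i _ => ?_
          rw [hpair, Real.cosh_eq]
          ring_nf
      _ ≤ ∏ i, (2 * Real.exp ((c * v j i) ^ 2 / 2)) :=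
          Finset.prod_le_prod (fun i _ => by positivity) fun i _ =>
            mul_le_mul_of_nonneg_left (Real.cosh_le_exp_half_sq _) (by norm_num)
      _ = 2 ^ d * Real.exp (s ^ 2 / 2) := by
          rw [Finset.prod_mul_distrib, ← Real.exp_sum]
          congr 2
          · simp
          · rw [← hc, ← Finset.sum_div]
            simp only [mul_pow]
            rw [← Finset.mul_sum, hv j hj, mul_one]
  have hcosh : ∀ j ∈ J,
      ∑ σ ∈ T, Real.cosh (s * ∑ i, v j i * σ i) ≤ 2 ^ d * Real.exp (s ^ 2 / 2) := by
    intro j hj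
    have h1 := hexp s j hj rfl
    have h2 := hexp (-s) j hj (by ring)
    have : ∑ σ ∈ T, Real.cosh (s * ∑ i, v j i * σ i) =
        (∑ σ ∈ T, Real.exp (s * ∑ i, v j i * σ i) +
          ∑ σ ∈ T, Real.exp (-s * ∑ i, v j i * σ i)) / 2 := by
      rw [← Finset.sum_add_distrib, Finset.sum_div]
      refine Finset.sum_congr rfl fun σ _ => ?_
      rw [Real.cosh_eq, neg_mul]
    linarith
  have hlow : ∀ σ ∈ T, Real.cosh (s * s) ≤ ∑ j ∈ J, Real.cosh (s * ∑ i, v j i * σ i) := by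
    intro σ hσ
    obtain ⟨j, hj, hsj⟩ := hcon σ (hT σ hσ)
    refine le_trans ?_ (Finset.single_le_sum
      (f := fun j => Real.cosh (s * ∑ i, v j i * σ i)) (fun j _ => (Real.cosh_pos _).le) hj)
    rw [Real.cosh_le_cosh, abs_mul, abs_mul]
    exact mul_le_mul_of_nonneg_left ((abs_of_nonneg hs).le.trans hsj) (abs_nonneg _)
  have htotal : 2 ^ d * Real.cosh (s * s) ≤ J.card * (2 ^ d * Real.exp (s ^ 2 / 2)) := by
    calc 2 ^ d * Real.cosh (s * s) = ∑ σ ∈ T, Real.cosh (s * s) := by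
          rw [Finset.sum_const, nsmul_eq_mul, hTcard]
      _ ≤ ∑ σ ∈ T, ∑ j ∈ J, Real.cosh (s * ∑ i, v j i * σ i) := Finset.sum_le_sum hlow
      _ = ∑ j ∈ J, ∑ σ ∈ T, Real.cosh (s * ∑ i, v j i * σ i) := Finset.sum_comm
      _ ≤ ∑ j ∈ J, 2 ^ d * Real.exp (s ^ 2 / 2) := Finset.sum_le_sum hcosh
      _ = J.card * (2 ^ d * Real.exp (s ^ 2 / 2)) := by rw [Finset.sum_const, nsmul_eq_mul]
  have hd : (0 : ℝ) < 2 ^ d := by positivity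
  have h3 : Real.cosh (s * s) ≤ J.card * Real.exp (s ^ 2 / 2) := by
    refine le_of_mul_le_mul_left ?_ hd
    linarith
  have h4 : Real.exp (s * s) / 2 < Real.cosh (s * s) := by
    rw [Real.cosh_eq]
    have := Real.exp_pos (-(s * s))
    linarith
  have h5 : Real.exp (s * s) = Real.exp (s ^ 2 / 2) * Real.exp (s ^ 2 / 2) := by
    rw [← Real.exp_add]
    ring_nf
  have h6 := mul_le_mul_of_nonneg_right hJ (Real.exp_pos (s ^ 2 / 2)).le
  linarith

/-- The standard basis of `ℝ^d` extends to `m` unit vectors with pairwise inner products at most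
`t` in absolute value, provided `2 m ≤ exp (d t² / 2)`. -/
theorem exists_incoherent_extension_of_basis {d : ℕ} (hd : 1 ≤ d) (t : ℝ) (ht : 0 ≤ t) (m : ℕ)
    (hdm : d ≤ m) (hm : 2 * (m : ℝ) ≤ Real.exp (d * t ^ 2 / 2)) :
    ∃ a : ℕ → Fin d → ℝ, (∀ i : Fin d, a i = Pi.single i 1) ∧
      (∀ j < m, a j ⬝ᵥ a j = 1) ∧ ∀ i < m, ∀ j < m, i ≠ j → |a i ⬝ᵥ a j| ≤ t := by
  induction m, hdm using Nat.le_induction with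
  | base =>
    refine ⟨fun j => if h : j < d then Pi.single ⟨j, h⟩ 1 else 0, fun i => by simp,
      fun j hj => by simp [hj], fun i hi j hj hij => ?_⟩
    have : (⟨j, hj⟩ : Fin d) ≠ ⟨i, hi⟩ := by simpa using hij.symm
    simpa [hi, hj, Pi.single_apply, this.symm] using ht
  | succ m hdm ih =>
    push_cast at hm
    obtain ⟨a, hbasis, hunit, hinner⟩ := ih (by linarith)
    have hd0 : (0 : ℝ) < d := by exact_mod_cast hd
    have hsq : √(d : ℝ) ^ 2 = d := Real.sq_sqrt hd0.le
    have hpos : 0 < √(d : ℝ) := Real.sqrt_pos.2 hd0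
    -- The new vector is σ/√d, so the threshold for σ itself is √d·t.
    obtain ⟨σ, hσ, hlt⟩ := exists_sign_vector_abs_sum_lt (Finset.range m) a
      (fun j hj => by
        rw [← hunit j (Finset.mem_range.1 hj)]
        simp [dotProduct, sq]) (√d * t) (by positivity)
      (by
        rw [Finset.card_range, mul_pow, hsq]
        linarith)
    have hnew : ∀ j < m, |a j ⬝ᵥ ((√(d : ℝ))⁻¹ • σ)| ≤ t := by
      intro j hj
      rw [dotProduct_smul, smul_eq_mul, abs_mul, abs_of_pos (inv_pos.2 hpos), inv_mul_le_iff₀ hpos]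
      exact (hlt j (Finset.mem_range.2 hj)).le
    refine ⟨Function.update a m ((√(d : ℝ))⁻¹ • σ), fun i => ?_, fun j hj => ?_,
      fun i hi j hj hij => ?_⟩
    · rw [Function.update_of_ne (by have := i.2; omega), hbasis]
    · rcases eq_or_ne j m with rfl | hne
      · rw [Function.update_self, dotProduct_smul, smul_dotProduct]
        have : σ ⬝ᵥ σ = d := by simp [dotProduct, ← sq, hσ]
        rw [this, smul_eq_mul, smul_eq_mul, ← hsq]
        simp only [hsq]
        field_simp
        exact hsq.symm
      · rw [Function.update_of_ne hne]
        exact hunit j (by omega)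
    · rcases eq_or_ne i m with rfl | hi'
      · rw [Function.update_self, Function.update_of_ne hij.symm, dotProduct_comm]
        exact hnew j (by omega)
      · rw [Function.update_of_ne hi']
        rcases eq_or_ne j m with rfl | hj'
        · rw [Function.update_self]
          exact hnew i (by omega)
        · rw [Function.update_of_ne hj']
          exact hinner i (by omega) j (by omega) hij

/-! ### Features whose misspecified class contains all needles -/

theorem span_eq_top_of_single_mem {d : ℕ} {s : Set (Fin d → ℝ)}
    (hs : ∀ i, Pi.single i 1 ∈ s) : Submodule.span ℝ s = ⊤ := by
  rw [eq_top_iff, ← (Pi.basisFun ℝ (Fin d)).span_eq]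
  refine Submodule.span_mono ?_
  rintro _ ⟨i, rfl⟩
  simpa using hs i

/-- Take θ = 0: the needle is all error. -/
theorem single_mem_misspecifiedClass_of_le {k d : ℕ} (Φ : Matrix (Fin k) (Fin d) ℝ) {c ε : ℝ}
    (hc : 0 ≤ c) (hcε : c ≤ ε) (i : Fin k) : Pi.single i c ∈ misspecifiedClass Φ ε := by
  refine Set.mem_add.2 ⟨0, ⟨0, by simp⟩, Pi.single i c, fun a => ?_, zero_add _⟩
  rw [Pi.single_apply]
  split_ifs <;> constructor <;> linarith

/-- Take θ = c·φᵢ: the error vanishes at i and is c⟨φₐ, φᵢ⟩ in absolute value at a ≠ i. -/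
theorem single_mem_misspecifiedClass_of_incoherent {k d : ℕ} (Φ : Matrix (Fin k) (Fin d) ℝ)
    {t c ε : ℝ} (hunit : ∀ i, Φ i ⬝ᵥ Φ i = 1) (hinner : ∀ i j, i ≠ j → |Φ i ⬝ᵥ Φ j| ≤ t)
    (hc : 0 ≤ c) (hcε : c * t ≤ ε) (hε : 0 ≤ ε) (i : Fin k) :
    Pi.single i c ∈ misspecifiedClass Φ ε := by
  refine Set.mem_add.2 ⟨Φ.mulVec (c • Φ i), ⟨_, rfl⟩, Pi.single i c - Φ.mulVec (c • Φ i),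
    fun a => ?_, by simp⟩
  have happ : Φ.mulVec (c • Φ i) a = c * (Φ a ⬝ᵥ Φ i) := by
    rw [Matrix.mulVec_smul]
    rfl
  rw [Set.mem_Icc, ← abs_le, Pi.sub_apply, happ]
  rcases eq_or_ne a i with rfl | hai
  · simpa [hunit] using hε
  · rw [Pi.single_eq_of_ne hai, zero_sub, abs_neg, abs_mul, abs_of_nonneg hc]
    exact (mul_le_mul_of_nonneg_left (hinner a i hai) hc).trans hcε

/-- After taking ninth powers this is 2⁹ ≤ k⁷, which fails for k = 2. The exponent is (d-1)t²/2 for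
the t used below. -/
theorem two_mul_le_exp_of_three_le {k : ℕ} (hk : 3 ≤ k) :
    2 * (k : ℝ) ≤ Real.exp (16 / 9 * Real.log k) := by
  have hk0 : (0 : ℝ) < k := by positivity
  have hk3 : (3 : ℝ) ≤ k := by exact_mod_cast hk
  refine le_of_pow_le_pow_left₀ (n := 9) (by norm_num) (Real.exp_pos _).le ?_
  have : Real.exp (16 / 9 * Real.log k) ^ 9 = (k : ℝ) ^ 16 := by
    rw [← Real.exp_nat_mul, ← Real.exp_log (pow_pos hk0 16), Real.log_pow]
    congr 1
    push_cast
    ring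
  rw [this, mul_pow]
  have h7 : (3 : ℝ) ^ 7 ≤ (k : ℝ) ^ 7 := pow_le_pow_left₀ (by norm_num) hk3 7
  calc (2 : ℝ) ^ 9 * (k : ℝ) ^ 9 ≤ (k : ℝ) ^ 7 * (k : ℝ) ^ 9 := by
        gcongr
        linarith
    _ = (k : ℝ) ^ 16 := by ring

/-- A feature matrix with distinct rows spanning `ℝ^d` whose misspecified classes contain a
needle at every action, of height `3/2 ε √((d - 1) / (8 log k))`. -/
theorem exists_features_single_mem_misspecifiedClass (d k : ℕ) (hd : 1 ≤ d) (hdk : d ≤ k)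
    (hk : 2 ≤ k) :
    ∃ Φ : Matrix (Fin k) (Fin d) ℝ,
      Function.Injective Φ.row ∧ Submodule.span ℝ (Set.range Φ.row) = ⊤ ∧
      ∀ ε : ℝ, 0 ≤ ε → ∀ i,
        Pi.single i (3 / 2 * (ε * √(((d : ℝ) - 1) / (8 * Real.log k)))) ∈
          misspecifiedClass Φ ε := by
  have hk1 : (1 : ℝ) < k := by exact_mod_cast hk
  have hd1 : (1 : ℝ) ≤ d := by exact_mod_cast hd
  have hlog : 0 < Real.log k := Real.log_pos hk1
  set w : ℝ := ((d : ℝ) - 1) / (8 * Real.log k) with hw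
  have hw0 : 0 ≤ w := div_nonneg (by linarith) (by positivity)
  -- The condition says that √w ≤ 2/3, that is, needle height at most ε.
  by_cases hcase : 9 * ((d : ℝ) - 1) ≤ 32 * Real.log k
  · have hsqrt : √w ≤ 2 / 3 := by
      refine Real.sqrt_le_iff.2 ⟨by norm_num, ?_⟩
      rw [hw, div_le_iff₀ (by positivity)]
      linarith
    -- Only distinctness and spanning matter here. The `+ 1` makes the extra multiples at least 2,
    -- hence distinct from the basis vector, even for d = 1.
    let Φ : Matrix (Fin k) (Fin d) ℝ := fun i =>
      if h : (i : ℕ) < d then Pi.single ⟨i, h⟩ 1 else Pi.single ⟨0, hd⟩ ((i : ℝ) + 1)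
    refine ⟨Φ, fun i j hij => ?_, span_eq_top_of_single_mem fun i => ?_, fun ε hε i => ?_⟩
    · have hij' : Φ i = Φ j := hij
      have happ := fun l => congrFun hij' l
      have h0 := happ ⟨0, hd⟩
      have hne : ∀ l : ℕ, (1 : ℝ) ≤ l → ((l : ℝ) + 1 ≠ 1 ∧ (1 : ℝ) ≠ l + 1 ∧ (l : ℝ) + 1 ≠ 0
          ∧ (0 : ℝ) ≠ l + 1) := fun l hl => by
        refine ⟨?_, ?_, ?_, ?_⟩ <;> intro h <;> linarith
      by_cases hi : (i : ℕ) < d <;> by_cases hj : (j : ℕ) < d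
      · have h1 := happ ⟨i, hi⟩
        simp only [Φ, hi, hj, dite_true, Pi.single_apply, Fin.mk.injEq, if_true] at h1
        by_contra hne'
        rw [if_neg (fun h => hne' (Fin.ext h))] at h1
        exact one_ne_zero h1
      · have := hne j (by exact_mod_cast (by omega : 1 ≤ (j : ℕ)))
        simp only [Φ, hi, hj, dite_true, dite_false, Pi.single_apply, if_true] at h0
        split_ifs at h0
        · exact absurd h0 this.2.1
        · exact absurd h0 this.2.2.2
      · have := hne i (by exact_mod_cast (by omega : 1 ≤ (i : ℕ)))
        simp only [Φ, hi, hj, dite_true, dite_false, Pi.single_apply, if_true] at h0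
        split_ifs at h0
        · exact absurd h0 this.1
        · exact absurd h0 this.2.2.1
      · simp only [Φ, hi, hj, dite_false, Pi.single_eq_same, add_left_inj, Nat.cast_inj] at h0
        exact Fin.ext h0
    · refine ⟨⟨i, i.2.trans_le hdk⟩, ?_⟩
      change Φ _ = _
      simp [Φ]
    · refine single_mem_misspecifiedClass_of_le Φ (by positivity) ?_ i
      have := mul_le_mul_of_nonneg_left hsqrt hε
      linarith
  · push Not at hcase
    have hk3 : 3 ≤ k := by
      by_contra hlt
      obtain rfl : k = 2 := by omega
      have hd2 : (d : ℝ) ≤ 2 := by exact_mod_cast hdk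
      have := Real.log_two_gt_d9
      norm_num at hcase
      linarith
    have hdpos : 0 < (d : ℝ) - 1 := by linarith
    -- Chosen so that (3/2)√w·t = 1; t < 1 then keeps the rows distinct.
    set t : ℝ := √(32 * Real.log k / (9 * ((d : ℝ) - 1))) with ht
    have htsq : t ^ 2 = 32 * Real.log k / (9 * ((d : ℝ) - 1)) := Real.sq_sqrt (by positivity)
    have ht1 : t < 1 := by
      rw [ht, Real.sqrt_lt' one_pos, one_pow, div_lt_one (by positivity)]
      exact hcase
    have hwt : 3 / 2 * √w * t = 1 := by
      have h1 : (3 / 2 * √w * t) ^ 2 = 1 ^ 2 := by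
        rw [mul_pow, mul_pow, Real.sq_sqrt hw0, htsq, hw]
        field_simp
        norm_num
      exact (pow_left_inj₀ (by positivity) zero_le_one two_ne_zero).1 h1
    obtain ⟨a, hbasis, hunit, hinner⟩ := exists_incoherent_extension_of_basis hd t
      (Real.sqrt_nonneg _) k hdk ((two_mul_le_exp_of_three_le hk3).trans (by
        refine Real.exp_le_exp.2 ?_
        have h2 : ((d : ℝ) - 1) * t ^ 2 = 32 / 9 * Real.log k := by
          rw [htsq]
          field_simp
        nlinarith [sq_nonneg t]))
    let Φ : Matrix (Fin k) (Fin d) ℝ := fun i => a i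
    refine ⟨Φ, fun i j hij => ?_, span_eq_top_of_single_mem fun i => ?_, fun ε hε i => ?_⟩
    · by_contra hne
      have hij' : a i = a j := hij
      have h1 := hinner i i.2 j j.2 (fun h => hne (Fin.ext h))
      rw [hij', hunit j j.2, abs_one] at h1
      linarith
    · exact ⟨⟨i, i.2.trans_le hdk⟩, hbasis i⟩
    · refine single_mem_misspecifiedClass_of_incoherent Φ (t := t) (fun i => hunit i i.2)
        (fun i j hij => hinner i i.2 j j.2 fun h => hij (Fin.ext h)) (by positivity) ?_ hε i
      have : 3 / 2 * (ε * √w) * t = ε * (3 / 2 * √w * t) := by ring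
      rw [this, hwt, mul_one]

/-! ### Regret summed over needle positions -/

namespace BanditAlgorithm

variable {k : ℕ} {S : Type*} [MeasurableSpace S]

/-- Mean reward vectors that agree on the actions taken so far produce the same history. -/
theorem history_congr (A : BanditAlgorithm k S) {μ ν : Fin k → ℝ} (s : S) (z : ℕ → ℝ) (t : ℕ)
    (h : ∀ r < t, μ (A.action ν s z r) = ν (A.action ν s z r)) :
    A.history μ s z t = A.history ν s z t := by
  induction t with
  | zero => rfl
  | succ t ih =>
    have ht := h t (Nat.lt_succ_self t)
    rw [action] at ht
    simp only [history, ih fun r hr => h r (hr.trans (Nat.lt_succ_self t)), ht]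

theorem measurable_history (A : BanditAlgorithm k S) (μ : Fin k → ℝ) {Ω : Type*}
    [MeasurableSpace Ω] {U : Ω → S} {η : ℕ → Ω → ℝ} (hU : Measurable U)
    (hη : ∀ t, Measurable (η t)) (t : ℕ) :
    Measurable fun ω => A.history μ (U ω) (fun r => η r ω) t := by
  induction t with
  | zero => exact measurable_const
  | succ t ih =>
    have hact : Measurable fun ω => A.choose t (U ω) (A.history μ (U ω) (fun r => η r ω) t) :=
      (A.measurable_choose t).comp (hU.prodMk ih)
    refine measurable_pi_iff.2 fun i => ?_
    simp only [history]
    induction i using Fin.lastCases with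
    | last =>
      simp only [Fin.snoc_last]
      exact hact.prodMk (((measurable_of_finite μ).comp hact).add (hη t))
    | cast i =>
      simp only [Fin.snoc_castSucc]
      exact (measurable_pi_apply i).comp ih

theorem measurable_action (A : BanditAlgorithm k S) (μ : Fin k → ℝ) {Ω : Type*}
    [MeasurableSpace Ω] {U : Ω → S} {η : ℕ → Ω → ℝ} (hU : Measurable U)
    (hη : ∀ t, Measurable (η t)) (t : ℕ) :
    Measurable fun ω => A.action μ (U ω) (fun r => η r ω) t :=
  (A.measurable_choose t).comp (hU.prodMk (A.measurable_history μ hU hη t))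

theorem integrable_sum_gap (A : BanditAlgorithm k S) (μ : Fin k → ℝ) {Ω : Type*}
    [MeasurableSpace Ω] (P : Measure Ω) [IsFiniteMeasure P] {U : Ω → S} {η : ℕ → Ω → ℝ}
    (hU : Measurable U) (hη : ∀ t, Measurable (η t)) (n : ℕ) :
    Integrable (fun ω => ∑ t ∈ Finset.range n,
      ((⨆ a, μ a) - μ (A.action μ (U ω) (fun r => η r ω) t))) P := by
  refine integrable_finsetSum _ fun t _ => Integrable.sub (integrable_const _) ?_
  refine Integrable.of_bound (C := ∑ a, |μ a|)
    ((measurable_of_finite μ).comp (A.measurable_action μ hU hη t)).aestronglyMeasurable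
    (Filter.Eventually.of_forall fun ω => ?_)
  exact Finset.single_le_sum (f := fun a => |μ a|) (fun a _ => abs_nonneg _) (Finset.mem_univ _)

theorem iSup_single [Nontrivial (Fin k)] (i : Fin k) {c : ℝ} (hc : 0 ≤ c) :
    ⨆ a, (Pi.single i c : Fin k → ℝ) a = c := by
  have hle : ∀ a, (Pi.single i c : Fin k → ℝ) a ≤ c := fun a => by
    rw [Pi.single_apply]
    split_ifs <;> linarith
  refine le_antisymm (ciSup_le hle) ?_
  have := le_ciSup (f := (Pi.single i c : Fin k → ℝ)) ⟨c, by rintro _ ⟨a, rfl⟩; exact hle a⟩ i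
  rwa [Pi.single_eq_same] at this

/-- Summed over the position of the needle, the gap suffered in round `t` is at least
`c (k - 1 - t)`, because at most `t + 1` positions have been tried. -/
theorem le_sum_gap_single (A : BanditAlgorithm k S) (s : S) (z : ℕ → ℝ) {c : ℝ}
    (hc : 0 ≤ c) (t : ℕ) :
    c * ((k : ℝ) - 1 - t) ≤
      ∑ i, (c - (Pi.single i c : Fin k → ℝ) (A.action (Pi.single i c) s z t)) := by
  classical
  -- The actions tried under mean zero, including round t itself; a needle outside `T` has not been
  -- seen and costs c in round t.
  let T : Finset (Fin k) := (Finset.range (t + 1)).image (A.action 0 s z)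
  have hT : T.card ≤ t + 1 := Finset.card_image_le.trans_eq (Finset.card_range _)
  have hgap : ∀ i, (if i ∈ T then 0 else c) ≤
      c - (Pi.single i c : Fin k → ℝ) (A.action (Pi.single i c) s z t) := by
    intro i
    split_ifs with hi
    · rw [Pi.single_apply]
      split_ifs <;> linarith
    · have hne : ∀ r < t + 1, A.action 0 s z r ≠ i := fun r hr h =>
        hi (Finset.mem_image.2 ⟨r, Finset.mem_range.2 hr, h⟩)
      have hhist : A.history (Pi.single i c) s z t = A.history 0 s z t :=
        A.history_congr s z t fun r hr => by
          rw [Pi.single_eq_of_ne (hne r (by omega)), Pi.zero_apply]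
      have hact : A.action (Pi.single i c) s z t = A.action 0 s z t := by
        rw [action, action, hhist]
      rw [hact, Pi.single_eq_of_ne (hne t (by omega)), sub_zero]
  refine le_trans ?_ (Finset.sum_le_sum fun i _ => hgap i)
  have hcompl : ∑ i, (if i ∈ T then 0 else c) = (Tᶜ.card : ℝ) * c := by
    rw [Finset.sum_ite, Finset.sum_const_zero, zero_add, Finset.sum_const, nsmul_eq_mul]
    congr 3
    ext i
    simp
  have hcard : (k : ℝ) - 1 - t ≤ Tᶜ.card := by
    rw [Finset.card_compl, Fintype.card_fin]
    have : k ≤ (k - T.card) + (t + 1) := by omega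
    have : (k : ℝ) ≤ ((k - T.card : ℕ) : ℝ) + (t + 1) := by exact_mod_cast this
    linarith
  rw [hcompl, mul_comm]
  exact mul_le_mul_of_nonneg_right hcard hc

/-- Only the first m rounds are counted, since the per-round bound turns negative for t ≥ k; the
gaps of the remaining rounds are nonnegative. -/
theorem le_sum_regret_single (hk : 2 ≤ k) (A : BanditAlgorithm k S) {Ω : Type*}
    [MeasurableSpace Ω] (P : Measure Ω) [IsProbabilityMeasure P] {U : Ω → S} {η : ℕ → Ω → ℝ}
    (hU : Measurable U) (hη : ∀ t, Measurable (η t)) {c : ℝ} (hc : 0 ≤ c) {m n : ℕ}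
    (hmn : m ≤ n) :
    c * (m * (2 * k - 1 - m) / 2) ≤ ∑ i, A.regret P U η (Pi.single i c) n := by
  have : Nontrivial (Fin k) := Fin.nontrivial_iff_two_le.2 hk
  have hint := fun i => A.integrable_sum_gap (Pi.single i c) P hU hη n
  have hsum : ∑ t ∈ Finset.range m, ((k : ℝ) - 1 - t) = m * (2 * k - 1 - m) / 2 := by
    clear hmn
    induction m with
    | zero => simp
    | succ m ih =>
      rw [Finset.sum_range_succ, ih]
      push_cast
      ring
  simp only [regret]
  rw [← integral_finsetSum _ fun i _ => hint i]
  have hconst : c * (m * (2 * k - 1 - m) / 2) = ∫ _, c * ((m : ℝ) * (2 * k - 1 - m) / 2) ∂P := by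
    simp
  rw [hconst]
  refine integral_mono (integrable_const _) (integrable_finsetSum _ fun i _ => hint i) fun ω => ?_
  simp only [iSup_single _ hc]
  rw [Finset.sum_comm, ← hsum, Finset.mul_sum]
  refine (Finset.sum_le_sum fun t _ => A.le_sum_gap_single (U ω) (fun r => η r ω) hc t).trans ?_
  refine Finset.sum_le_sum_of_subset_of_nonneg (Finset.range_subset_range.2 hmn)
    fun t _ _ => Finset.sum_nonneg fun i _ => ?_
  rw [Pi.single_apply]
  split_ifs <;> linarith

end BanditAlgorithm

/-- Chooses the truncation m so that averaging over k needles of height 3δ/2 leaves the claimed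
bound: all n rounds if 2n < k, otherwise min(n, k-1), which lies between k/2 and k-1. -/
theorem exists_le_mul_min_le {k : ℕ} (hk : 2 ≤ k) (n : ℕ) :
    ∃ m ≤ n, (k : ℝ) * min (n : ℝ) (((k : ℝ) - 1) / 2) ≤
      3 / 2 * ((m : ℝ) * (2 * k - 1 - m) / 2) := by
  have hk2 : (2 : ℝ) ≤ k := by exact_mod_cast hk
  rcases Nat.lt_or_ge (2 * n) k with h | h
  · refine ⟨n, le_rfl, (mul_le_mul_of_nonneg_left (min_le_left _ _) (by linarith)).trans ?_⟩
    rcases Nat.eq_zero_or_pos n with rfl | hn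
    · simp
    · have h' : 2 * (n : ℝ) + 1 ≤ k := by exact_mod_cast h
      have hn' : (1 : ℝ) ≤ n := by exact_mod_cast hn
      nlinarith
  · refine ⟨min n (k - 1), min_le_left _ _,
      (mul_le_mul_of_nonneg_left (min_le_right _ _) (by linarith)).trans ?_⟩
    have h1 : (k : ℝ) ≤ 2 * (min n (k - 1) : ℕ) := by
      exact_mod_cast (by omega : k ≤ 2 * min n (k - 1))
    have h2 : ((min n (k - 1) : ℕ) : ℝ) + 1 ≤ k := by
      exact_mod_cast (by omega : min n (k - 1) + 1 ≤ k)
    nlinarith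

theorem mainTheorem9 (d k : ℕ) (hd : 1 ≤ d) (hdk : d ≤ k) (hk : 2 ≤ k) :
    ∃ Φ : Matrix (Fin k) (Fin d) ℝ,
      Function.Injective Φ.row ∧ Submodule.span ℝ (Set.range Φ.row) = ⊤ ∧
      ∀ (ε : ℝ), 0 ≤ ε → ∀ (n : ℕ)
        (S : Type*) [MeasurableSpace S] (A : BanditAlgorithm k S)
        (Ω : Type*) [MeasurableSpace Ω] (P : Measure Ω) [IsProbabilityMeasure P]
        (U : Ω → S) (η : ℕ → Ω → ℝ),
        Measurable U → P.map U = A.seedLaw →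
        (∀ t, Measurable (η t)) → (∀ t, HasSubgaussianMGF (η t) 1 P) → iIndepFun η P →
        IndepFun U (fun ω t => η t ω) P →
        ∃ μ ∈ misspecifiedClass Φ ε,
          (∀ a b, μ a - μ b ≤ 2 * ε * √(((d : ℝ) - 1) / (8 * Real.log k))) ∧
          ε * min (n : ℝ) (((k : ℝ) - 1) / 2) * √(((d : ℝ) - 1) / (8 * Real.log k))
            ≤ A.regret P U η μ n := by
  obtain ⟨Φ, hinj, hspan, hΦ⟩ := exists_features_single_mem_misspecifiedClass d k hd hdk hk
  refine ⟨Φ, hinj, hspan, fun ε hε n S _ A Ω _ P _ U η hU _ hη _ _ _ => ?_⟩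
  set δ : ℝ := ε * √(((d : ℝ) - 1) / (8 * Real.log k)) with hδ
  have hδ0 : 0 ≤ δ := by positivity
  have hk0 : (0 : ℝ) < k := by positivity
  obtain ⟨m, hmn, hm⟩ := exists_le_mul_min_le hk n
  have hregret := A.le_sum_regret_single hk P hU hη (c := 3 / 2 * δ) (by positivity) hmn
  have hlower : ∑ _i : Fin k, δ * min (n : ℝ) (((k : ℝ) - 1) / 2) ≤
      ∑ i, A.regret P U η (Pi.single i (3 / 2 * δ)) n := by
    refine le_trans ?_ hregret
    rw [Finset.sum_const, Finset.card_univ, Fintype.card_fin, nsmul_eq_mul]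
    have := mul_le_mul_of_nonneg_left hm hδ0
    linarith
  have : Nonempty (Fin k) := ⟨⟨0, by omega⟩⟩
  obtain ⟨i, -, hi⟩ := Finset.exists_le_of_sum_le Finset.univ_nonempty hlower
  refine ⟨Pi.single i (3 / 2 * δ), hΦ ε hε i, fun a b => ?_, ?_⟩
  · have hbound : 2 * ε * √(((d : ℝ) - 1) / (8 * Real.log k)) = 2 * δ := by
      rw [hδ]
      ring
    rw [hbound, Pi.single_apply, Pi.single_apply]
    split_ifs <;> linarith
  · refine le_trans (le_of_eq ?_) hi
    rw [hδ]
    ring
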